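/- Let $g_0,\rho,\omega\in\mathbb R$ with $\rho>0$ and $\omega\neq0$ (a counterclockwise loop for $\omega>0$, a clockwise one for $\omega<0$). For a starting angle $\theta_i\in\mathbb R$ consider the noiseless evolution equation $$ i\,\partial_t\psi(t)=H(t)\psi(t),\qquad H(t)=\begin{pmatrix}h_z(t)&1\\1&-h_z(t)\end{pmatrix},\qquad h_z(t)=i\bigl(g_0-\rho\,e^{i(\omega t+\theta_i)}\bigr),$$ for $\psi(t)=(a(t),b(t))^T\in\mathbb C^2$, $t\in\mathbb R$. The transfer matrix $S(\theta_f,\theta_i)$ is the $2\times2$ matrix such that, for every $\theta_i$ and every $\psi_0\in\mathbb C^2$, the function $t\mapsto S(\theta_i+\omega t,\theta_i)\psi_0$ is the one and only solution with $\psi(0)=\psi_0$. Let $r=\sqrt{1-g_0^2}$ be either complex square root of $1-g_0^2$, and put $$p_1=\frac{ig_0+r}{\omega},\qquad p_2=1+\frac{2r}{\omega},\qquad \eta(\theta)=-2i\,\frac{\rho}{\omega}\,e^{i\theta},\qquad \eta_{f,i}=\eta(\theta_{f,i}).$$ Assume $p_2\notin\{0,-1,-2,\dots\}$ (this is automatic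 if $\omega>0$ and $r$ is the principal root). Let $F(a,b,z)=\sum_{n\ge0}\frac{(a)_n}{(b)_n\,n!}z^n$ be the confluent hypergeometric function of the first kind, and let $$U(a,b,z)=\frac{\pi}{\sin\pi b}\left[\frac{F(a,b,z)}{\Gamma(1+a-b)\Gamma(b)}-z^{1-b}\,\frac{F(1+a-b,2-b,z)}{\Gamma(a)\Gamma(2-b)}\right]$$ (the limit $b'\to b$ of this expression when $b\in\mathbb Z$) be that of the second kind. All multivalued functions of $\eta$, namely $U$ and powers of $\eta$, are evaluated along the loop with one continuous logarithm $\log\eta(\theta)=c+i\theta$, where $c$ is any complex number with $e^c=-2i\rho/\omega$. Write $F^{(n)}=F(n+p_1,n+p_2,\eta)$, $U^{(n)}=U(n+p_1,n+p_2,\eta)$ and $$M(\eta)=\begin{pmatrix}\dfrac{F^{(0)}}{\omega p_1}&\dfrac{U^{(0)}}{\omega p_1}\\[2mm]-F^{(0)}-\dfrac{\eta}{p_2}F^{(1)}&-U^{(0)}+\eta\,U^{(1)}\end{pmatrix},\qquad \tilde M(\eta)=\begin{pmatrix}-\omega p_1\bigl(U^{(0)}-\eta\,U^{(1)}\bigr)&-U^{(0)}\\[1mm]\omega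 p_1\bigl(F^{(0)}+\dfrac{\eta}{p_2}F^{(1)}\bigr)&F^{(0)}\end{pmatrix}.$$ Then the transfer matrix exists, is unique, and for all $\theta_f,\theta_i\in\mathbb R$ $$S(\theta_f,\theta_i)=\frac{\Gamma(p_1)\,e^{i(\theta_f-\theta_i)r/\omega}\,p_1\,\eta_i^{\,p_2-1}}{\Gamma(p_2)\,e^{(\eta_f+\eta_i)/2}}\;M(\eta_f)\,\tilde M(\eta_i).$$ -/

import Mathlib

noncomputable section

namespace CircularLoop

/-- The confluent hypergeometric (Kummer) function of the first kind, `F(a, b, z) = ₁F₁(a; b; z)`,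
for `b` not a non-positive integer. Mathlib's `Complex.regularizedHGFun {a} {b}` is the entire
function `z ↦ ∑ (a)ₙ zⁿ / (Γ(b + n) n!)`. -/
def kummerF (a b z : ℂ) : ℂ :=
  Complex.Gamma b * Complex.regularizedHGFun {a} {b} z

/-- The usual series `F(a, b, z) = ∑ (a)ₙ zⁿ / ((b)ₙ n!)`. -/
theorem kummerF_eq_tsum (a b z : ℂ) (hb : ∀ n : ℕ, b ≠ -n) :
    kummerF a b z = ∑' n : ℕ, (ascPochhammer ℂ n).eval a /
      ((ascPochhammer ℂ n).eval b * (n.factorial : ℂ)) * z ^ n := by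
  have hG : Complex.Gamma b ≠ 0 := Complex.Gamma_ne_zero hb
  unfold kummerF Complex.regularizedHGFun Complex.regularizedHGFunSeries
  rw [← FormalMultilinearSeries.ofScalarsSum, FormalMultilinearSeries.ofScalarsSum_eq_tsum,
    ← tsum_mul_left]
  congr 1
  ext n
  rw [← Complex.Gamma_add_nat_div_Gamma_eq b hb]
  simp only [Complex.regularizedHGFunCoeff, Multiset.map_singleton, Multiset.prod_singleton,
    smul_eq_mul]
  field_simp

/-- For `b ∉ ℤ`: the expression
`π / sin (π b) * (F(a,b,z) / (Γ(1+a-b) Γ(b)) - z^(1-b) F(1+a-b,2-b,z) / (Γ(a) Γ(2-b)))`,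
with `z = e^ζ` and `z^(1-b) = e^((1-b)ζ)`. (`1/Γ` vanishes at the poles of `Γ`, in agreement with
Mathlib's values `Γ = 0` and `1/0 = 0` there.) -/
def kummerUGeneric (a b ζ : ℂ) : ℂ :=
  Real.pi / Complex.sin (Real.pi * b) *
    (Complex.regularizedHGFun {a} {b} (Complex.exp ζ) / Complex.Gamma (1 + a - b)
      - Complex.exp ((1 - b) * ζ) *
        Complex.regularizedHGFun {1 + a - b} {2 - b} (Complex.exp ζ) / Complex.Gamma a)

/-- The confluent hypergeometric (Kummer/Tricomi) function of the second kind `U(a, b, z)`. As an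
analytic function of `z` it lives on the Riemann surface of the logarithm; the argument here is
`ζ = log z` on that surface, so `-π < Im ζ ≤ π` is the principal branch at `z = e^ζ`.
It is the limit of `kummerUGeneric a b' ζ` as `b' → b`: this is the value at `b` itself if `b ∉ ℤ`
(by continuity), and the standard definition if `b ∈ ℤ`. -/
def kummerU (a b ζ : ℂ) : ℂ :=
  Filter.limUnder (nhdsWithin b {b}ᶜ) (fun b' => kummerUGeneric a b' ζ)

/-- The Hamiltonian `σ_x + h_z(t) σ_z` with `h_z(t) = i (g₀ - ρ e^(i(ωt + θᵢ)))`. -/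
def hamiltonian (g₀ ρ ω θi t : ℝ) : Matrix (Fin 2) (Fin 2) ℂ :=
  let hz : ℂ := Complex.I * (g₀ - ρ * Complex.exp (Complex.I * (ω * t + θi)))
  !![hz, 1; 1, -hz]

/-- `ψ = (a, b)` solves the evolution equation `i ∂ₜψ = H(t) ψ`. -/
def IsEvolution (g₀ ρ ω θi : ℝ) (ψ : ℝ → Fin 2 → ℂ) : Prop :=
  ∀ t : ℝ, HasDerivAt ψ (-Complex.I • (hamiltonian g₀ ρ ω θi t).mulVec (ψ t)) t

/-- `S(θ_f, θᵢ)` is the transfer matrix of the loop: for every starting angle `θᵢ` and every initial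
state `ψ₀`, the solutions of the evolution equation with `ψ(0) = ψ₀` are exactly the function
`ψ(t) = S(θᵢ + ωt, θᵢ) ψ₀`. -/
def IsTransferMatrix (g₀ ρ ω : ℝ) (S : ℝ → ℝ → Matrix (Fin 2) (Fin 2) ℂ) : Prop :=
  ∀ (θi : ℝ) (ψ₀ : Fin 2 → ℂ) (ψ : ℝ → Fin 2 → ℂ),
    (IsEvolution g₀ ρ ω θi ψ ∧ ψ 0 = ψ₀) ↔ ∀ t : ℝ, ψ t = (S (θi + ω * t) θi).mulVec ψ₀

/-- The matrix `M(η)` at `η = e^ζ`, where `F⁽ⁿ⁾ = F(n+p₁, n+p₂, η)`, `U⁽ⁿ⁾ = U(n+p₁, n+p₂, η)`. -/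
def matM (ω : ℝ) (p₁ p₂ ζ : ℂ) : Matrix (Fin 2) (Fin 2) ℂ :=
  let η := Complex.exp ζ
  let F0 := kummerF p₁ p₂ η
  let F1 := kummerF (1 + p₁) (1 + p₂) η
  let U0 := kummerU p₁ p₂ ζ
  let U1 := kummerU (1 + p₁) (1 + p₂) ζ
  !![F0 / (ω * p₁), U0 / (ω * p₁);
     -F0 - η / p₂ * F1, -U0 + η * U1]

/-- The matrix `M̃(η)` at `η = e^ζ`. -/
def matMtilde (ω : ℝ) (p₁ p₂ ζ : ℂ) : Matrix (Fin 2) (Fin 2) ℂ :=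
  let η := Complex.exp ζ
  let F0 := kummerF p₁ p₂ η
  let F1 := kummerF (1 + p₁) (1 + p₂) η
  let U0 := kummerU p₁ p₂ ζ
  let U1 := kummerU (1 + p₁) (1 + p₂) ζ
  !![-ω * p₁ * (U0 - η * U1), -U0;
     ω * p₁ * (F0 + η / p₂ * F1), F0]

/-- `η(θ) = -2i (ρ/ω) e^(iθ)`. -/
def eta (ρ ω θ : ℝ) : ℂ := -2 * Complex.I * (ρ / ω) * Complex.exp (Complex.I * θ)

/-- The logarithm of `η(θ) = -2i(ρ/ω)e^(iθ)` continued along the loop, given a logarithm `c` of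
`-2iρ/ω`. -/
def logEta (c : ℂ) (θ : ℝ) : ℂ := c + Complex.I * θ

theorem exp_logEta {ρ ω : ℝ} {c : ℂ} (hc : Complex.exp c = -2 * Complex.I * (ρ / ω)) (θ : ℝ) :
    Complex.exp (logEta c θ) = eta ρ ω θ := by
  rw [logEta, Complex.exp_add, hc, eta]

end CircularLoop

end

/-! Put `ζ = log η`. After the scalar factor `exp (i r t - η/2)` is removed, the evolution equation
becomes the system `X₀' = -p₁ e^ζ X₁`, `X₁' = (e^ζ - p₂) X₁ - X₀`, a first-order form of Kummer's
equation with parameters `p₁, p₂`. This rests on `(i g₀ + r)(r - i g₀) = 1`, that is, `1/(ω p₁) = r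
- i g₀`. Both `(F⁽⁰⁾, -F⁽¹⁾/p₂)` and `(U⁽⁰⁾, U⁽¹⁾)` solve the system, so the columns of `M(η)`,
times the scalar factor, solve the evolution equation (`isEvolution_of_kummer_system`).

The dependence on `θᵢ` is then fixed by `S(θ, θ) = 1`. The matrix `M̃` is `ω p₁` times the adjugate
of `M`, and `ω p₁ det M` is the Wronskian of `F` and `U`, an explicit exponential
(`kummerU_wronskian`); its inverse is the Gamma and power prefactor. Uniqueness holds because the
equation is linear with bounded coefficients.

Two points need care. When `p₂` is an integer, `U` is only a limit in its second parameter; its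
differential relations survive because the limit at a removable singularity is an average over a
circle of nearby parameters (`hasDerivAt_of_tendsto_parameter`). And `Γ(p₁)` must be finite and
nonzero, which follows from the hypothesis on `p₂` (`ne_neg_nat_of_exponents`). -/

noncomputable section

open Filter Topology Set

namespace CircularLoop

/-! ### The regularized Kummer series: convergence and holomorphy in all arguments -/

/-- The `n`-th term of the regularized Kummer series. -/
def regTerm (n : ℕ) (a b z : ℂ) : ℂ :=
  (ascPochhammer ℂ n).eval a * (Complex.Gamma (b + n))⁻¹ * ((n.factorial : ℂ))⁻¹ * z ^ n

/-- The regularized Kummer function `F(a, b, z) / Γ(b)`. -/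
abbrev regF (a b z : ℂ) : ℂ := Complex.regularizedHGFun {a} {b} z

theorem regF_eq_tsum (a b z : ℂ) : regF a b z = ∑' n, regTerm n a b z := by
  unfold regF Complex.regularizedHGFun Complex.regularizedHGFunSeries
  rw [← FormalMultilinearSeries.ofScalarsSum, FormalMultilinearSeries.ofScalarsSum_eq_tsum]
  refine tsum_congr fun n => ?_
  simp only [Complex.regularizedHGFunCoeff, Multiset.map_singleton, Multiset.prod_singleton,
    smul_eq_mul, regTerm, div_eq_mul_inv, mul_inv]
  ring

theorem inv_Gamma_eq (s : ℂ) : (Complex.Gamma s)⁻¹ = s * (Complex.Gamma (s + 1))⁻¹ :=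
  Complex.one_div_Gamma_eq_self_mul_one_div_Gamma_add_one s

theorem ascPochhammer_succ_eval_left (n : ℕ) (a : ℂ) :
    (ascPochhammer ℂ (n + 1)).eval a = a * (ascPochhammer ℂ n).eval (a + 1) := by
  simp [ascPochhammer_succ_left]

theorem inv_factorial_eq (n : ℕ) :
    ((n.factorial : ℂ))⁻¹ = (n + 1) * (((n + 1).factorial : ℂ))⁻¹ := by
  have := Nat.factorial_ne_zero n
  have h : (n : ℂ) + 1 ≠ 0 := by exact_mod_cast n.succ_ne_zero
  push_cast [Nat.factorial_succ]
  field_simp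

theorem regTerm_succ (n : ℕ) (a b z : ℂ) :
    (b + n) * (n + 1) * regTerm (n + 1) a b z = (a + n) * z * regTerm n a b z := by
  rw [regTerm, regTerm, inv_Gamma_eq (b + n), inv_factorial_eq n, ascPochhammer_succ_eval]
  push_cast
  ring_nf

theorem continuous_regTerm (n : ℕ) :
    Continuous fun p : ℂ × ℂ × ℂ => regTerm n p.1 p.2.1 p.2.2 := by
  unfold regTerm
  have h1 : Continuous fun x : ℂ => (Complex.Gamma x)⁻¹ :=
    Complex.differentiable_one_div_Gamma.continuous
  have h2 : Continuous fun x : ℂ => (ascPochhammer ℂ n).eval x := Polynomial.continuous _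
  have h3 : Continuous fun p : ℂ × ℂ × ℂ => (Complex.Gamma (p.2.1 + n))⁻¹ :=
    h1.comp (by fun_prop : Continuous fun p : ℂ × ℂ × ℂ => p.2.1 + n)
  have h4 : Continuous fun p : ℂ × ℂ × ℂ => (ascPochhammer ℂ n).eval p.1 :=
    h2.comp continuous_fst
  fun_prop

theorem differentiable_regTerm_comp (n : ℕ) {f g h : ℂ → ℂ} (hf : Differentiable ℂ f)
    (hg : Differentiable ℂ g) (hh : Differentiable ℂ h) :
    Differentiable ℂ fun w => regTerm n (f w) (g w) (h w) := by
  unfold regTerm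
  have h1 : Differentiable ℂ fun w => (Complex.Gamma (g w + n))⁻¹ :=
    Complex.differentiable_one_div_Gamma.comp (hg.add_const _)
  have h2 : Differentiable ℂ fun w => (ascPochhammer ℂ n).eval (f w) :=
    ((ascPochhammer ℂ n).differentiable.comp hf :)
  fun_prop

/-- On bounded sets of parameters, the terms are eventually at least halved at every step. -/
theorem norm_regTerm_succ_le {B : ℝ} {n : ℕ} (hB : 0 ≤ B) (hn : 1 + 6 * B + 4 * B ^ 2 ≤ n)
    {a b z : ℂ} (ha : ‖a‖ ≤ B) (hb : ‖b‖ ≤ B) (hz : ‖z‖ ≤ B) :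
    ‖regTerm (n + 1) a b z‖ ≤ ‖regTerm n a b z‖ / 2 := by
  have h := congrArg norm (regTerm_succ n a b z)
  simp only [norm_mul] at h
  have h1 : ‖((n : ℂ) + 1)‖ = n + 1 := by
    rw [show ((n : ℂ) + 1) = ((n + 1 : ℝ) : ℂ) by push_cast; ring, Complex.norm_real,
      Real.norm_of_nonneg (by positivity)]
  have h2 : ‖a + n‖ ≤ B + n := (norm_add_le _ _).trans (by simpa using ha)
  have h3 : (n : ℝ) - B ≤ ‖b + n‖ := by
    have := norm_sub_norm_le (n : ℂ) (-b)
    simp only [sub_neg_eq_add, norm_neg, Complex.norm_natCast] at this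
    rw [add_comm b]; linarith
  rw [h1] at h
  have hx := norm_nonneg (regTerm (n + 1) a b z)
  have hy := norm_nonneg (regTerm n a b z)
  have hn0 : (0 : ℝ) ≤ n := n.cast_nonneg
  have h4 : (n - B) * (n + 1) * ‖regTerm (n + 1) a b z‖ ≤ (B + n) * B * ‖regTerm n a b z‖ := by
    calc _ ≤ ‖b + n‖ * (n + 1) * ‖regTerm (n + 1) a b z‖ := by gcongr
      _ = _ := h
      _ ≤ _ := by gcongr
  -- The ratio of consecutive terms is at most `(B + n) B / ((n - B)(n + 1))`; the threshold on `n`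
  -- is chosen to make this at most `1/2`.
  have h5 : 2 * ((B + n) * B) ≤ (n - B) * (n + 1) := by
    nlinarith [sq_nonneg B, mul_nonneg hn0 (by nlinarith : 0 ≤ (n : ℝ) - 6 * B),
      mul_nonneg hB (by nlinarith : 0 ≤ (n : ℝ) - 6 * B - 1)]
  have h6 : 0 < (n - B) * (n + 1) := by
    have : 0 < (n : ℝ) - B := by nlinarith
    positivity
  have h7 : (n - B) * (n + 1) * ‖regTerm (n + 1) a b z‖ ≤
      (n - B) * (n + 1) * (‖regTerm n a b z‖ / 2) := by
    refine h4.trans ?_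
    nlinarith
  exact le_of_mul_le_mul_left h7 h6

/-- The majorant is uniform in the parameters as well as in `z`, because the limit defining `U`
moves `b`. Compactness bounds the terms up to index `N` by `C`; from there on halving gives `C 2^N
2^(-n)`. -/
theorem exists_summable_bound (B : ℝ) : ∃ u : ℕ → ℝ, Summable u ∧ ∀ (n : ℕ) (a b z : ℂ),
    ‖a‖ ≤ B → ‖b‖ ≤ B → ‖z‖ ≤ B → ‖regTerm n a b z‖ ≤ u n := by
  rcases lt_or_ge B 0 with hB | hB
  · exact ⟨0, summable_zero, fun n a b z ha => absurd (ha.trans_lt hB) (norm_nonneg a).not_gt⟩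
  obtain ⟨N, hN⟩ := exists_nat_ge (1 + 6 * B + 4 * B ^ 2)
  let K : Set (ℂ × ℂ × ℂ) := Metric.closedBall 0 B ×ˢ Metric.closedBall 0 B ×ˢ Metric.closedBall 0 B
  have hK : IsCompact K := (isCompact_closedBall _ _).prod
    ((isCompact_closedBall _ _).prod (isCompact_closedBall _ _))
  have hc : Continuous fun p : ℂ × ℂ × ℂ =>
      ∑ n ∈ Finset.range (N + 1), ‖regTerm n p.1 p.2.1 p.2.2‖ :=
    continuous_finsetSum _ fun n _ => (continuous_regTerm n).norm
  obtain ⟨C, hC⟩ := hK.exists_bound_of_continuousOn hc.continuousOn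
  have key : ∀ (n : ℕ) (a b z : ℂ), ‖a‖ ≤ B → ‖b‖ ≤ B → ‖z‖ ≤ B → n ≤ N →
      ‖regTerm n a b z‖ ≤ C := by
    intro n a b z ha hb hz hn
    refine le_trans ?_ ((le_abs_self _).trans (hC (a, b, z) (by simp [K, ha, hb, hz])))
    exact Finset.single_le_sum (f := fun n => ‖regTerm n a b z‖) (fun _ _ => norm_nonneg _)
      (Finset.mem_range.2 (Nat.lt_succ_of_le hn))
  have hC0 : 0 ≤ C := (norm_nonneg _).trans (key 0 0 0 0 (by simpa) (by simpa) (by simpa) N.zero_le)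
  refine ⟨fun n => C * 2 ^ N * (1 / 2) ^ n, summable_geometric_two.mul_left _, ?_⟩
  intro n a b z ha hb hz
  rcases le_total n N with hn | hn
  · refine (key n a b z ha hb hz hn).trans ?_
    dsimp only
    rw [mul_assoc]
    refine le_mul_of_one_le_right hC0 ?_
    rw [one_div, inv_pow, ← div_eq_mul_inv, one_le_div (by positivity)]
    exact pow_le_pow_right₀ (by norm_num) hn
  · induction n, hn using Nat.le_induction with
    | base =>
      have : C * 2 ^ N * (1 / 2) ^ N = C := by
        rw [mul_assoc, ← mul_pow]; norm_num
      exact (key N a b z ha hb hz le_rfl).trans this.ge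
    | succ n hn ih =>
      refine (norm_regTerm_succ_le hB (hN.trans (by exact_mod_cast hn)) ha hb hz).trans ?_
      dsimp only at ih ⊢
      rw [pow_succ]
      linarith

theorem summable_regTerm (a b z : ℂ) : Summable fun n => regTerm n a b z := by
  obtain ⟨u, hu, h⟩ := exists_summable_bound (max ‖a‖ (max ‖b‖ ‖z‖))
  exact .of_norm_bounded hu fun n => h n a b z (by simp) (by simp) (by simp)

theorem hasSum_regF (a b z : ℂ) : HasSum (fun n => regTerm n a b z) (regF a b z) := by
  rw [regF_eq_tsum]
  exact (summable_regTerm a b z).hasSum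

theorem continuous_regF : Continuous fun p : ℂ × ℂ × ℂ => regF p.1 p.2.1 p.2.2 := by
  simp only [regF_eq_tsum]
  rw [continuous_iff_continuousAt]
  intro p
  obtain ⟨u, hu, h⟩ := exists_summable_bound (‖p‖ + 1)
  have hc : ContinuousOn (fun q : ℂ × ℂ × ℂ => ∑' n, regTerm n q.1 q.2.1 q.2.2)
      (Metric.ball 0 (‖p‖ + 1)) := by
    refine continuousOn_tsum (fun n => (continuous_regTerm n).continuousOn) hu fun n q hq => ?_
    have hq' : ‖q‖ ≤ ‖p‖ + 1 := by simpa using (mem_ball_zero_iff.1 hq).le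
    exact h n _ _ _ ((norm_fst_le q).trans hq') ((norm_fst_le q.2).trans ((norm_snd_le q).trans hq'))
      ((norm_snd_le q.2).trans ((norm_snd_le q).trans hq'))
  exact hc.continuousAt (Metric.isOpen_ball.mem_nhds (by simp))

/-- Letting all three arguments vary holomorphically covers both the derivative in `z` and the
holomorphy in `b` with one termwise differentiation. -/
theorem regF_local {f g h : ℂ → ℂ} (hf : Differentiable ℂ f)
    (hg : Differentiable ℂ g) (hh : Differentiable ℂ h) (w : ℂ) :
    HasSum (fun n => deriv (fun w => regTerm n (f w) (g w) (h w)) w)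
      (deriv (fun w => regF (f w) (g w) (h w)) w) ∧
    DifferentiableAt ℂ (fun w => regF (f w) (g w) (h w)) w := by
  simp only [regF_eq_tsum]
  have hc : Continuous fun w => (f w, g w, h w) :=
    hf.continuous.prodMk (hg.continuous.prodMk hh.continuous)
  obtain ⟨C, hC⟩ := (isCompact_closedBall w 1).exists_bound_of_continuousOn hc.continuousOn
  obtain ⟨u, hu, hb⟩ := exists_summable_bound C
  have hle : ∀ (n : ℕ) (x : ℂ), x ∈ Metric.ball w 1 → ‖regTerm n (f x) (g x) (h x)‖ ≤ u n := by
    intro n x hx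
    have := hC x (Metric.ball_subset_closedBall hx)
    exact hb n _ _ _ ((norm_fst_le _).trans this)
      ((norm_fst_le (g x, h x)).trans ((norm_snd_le (f x, g x, h x)).trans this))
      ((norm_snd_le (g x, h x)).trans ((norm_snd_le (f x, g x, h x)).trans this))
  have hd := fun n => (differentiable_regTerm_comp n hf hg hh).differentiableOn
    (s := Metric.ball w 1)
  have hw : w ∈ Metric.ball w 1 := by simp
  exact ⟨Complex.hasSum_deriv_of_summable_norm hu hd Metric.isOpen_ball hle hw,
    (Complex.differentiableOn_tsum_of_summable_norm hu hd Metric.isOpen_ball hle).differentiableAt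
      (Metric.isOpen_ball.mem_nhds hw)⟩

theorem differentiable_regF_comp {f g h : ℂ → ℂ} (hf : Differentiable ℂ f)
    (hg : Differentiable ℂ g) (hh : Differentiable ℂ h) :
    Differentiable ℂ fun w => regF (f w) (g w) (h w) :=
  fun w => (regF_local hf hg hh w).2

/-! ### Derivative, contiguous relations and Wronskian of the regularized series -/

theorem hasDerivAt_regF (a b z : ℂ) :
    HasDerivAt (regF a b) (a * regF (a + 1) (b + 1) z) z := by
  obtain ⟨hs, hd⟩ := regF_local (differentiable_const a) (differentiable_const b)
    differentiable_id z
  have hderiv : ∀ n, deriv (fun w => regTerm n a b (id w)) z =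
      (ascPochhammer ℂ n).eval a * (Complex.Gamma (b + n))⁻¹ * ((n.factorial : ℂ))⁻¹ *
        (n * z ^ (n - 1)) := fun n => ((hasDerivAt_pow n z).const_mul _).deriv
  have h2 : HasSum (fun n => deriv (fun w => regTerm n a b (id w)) z)
      (a * regF (a + 1) (b + 1) z) := by
    rw [← hasSum_nat_add_iff' 1]
    simp only [Finset.range_one, Finset.sum_singleton, hderiv, Nat.cast_zero, zero_mul, mul_zero,
      sub_zero]
    convert! (hasSum_regF (a + 1) (b + 1) z).mul_left a using 2 with n
    rw [regTerm, ascPochhammer_succ_eval_left, inv_factorial_eq n, Nat.add_sub_cancel]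
    push_cast
    ring_nf
  rw [← hs.unique h2]
  exact hd.hasDerivAt

theorem hasSum_mul_regF_succ (a b z : ℂ) :
    HasSum (fun n : ℕ => n * regTerm n a b z) (z * (a * regF (a + 1) (b + 1) z)) := by
  rw [← hasSum_nat_add_iff' 1]
  simp only [Finset.range_one, Finset.sum_singleton, Nat.cast_zero, zero_mul, sub_zero]
  convert! ((hasSum_regF (a + 1) (b + 1) z).mul_left a).mul_left z using 2 with n
  rw [regTerm, regTerm, ascPochhammer_succ_eval_left, inv_factorial_eq n]
  push_cast
  ring_nf

/-- This and the next two relations are coefficient identities. Here `1/Γ(b+n) = (b+n)/Γ(b+n+1)`,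
the factor `n` acting as `z d/dz`; next `a + n = (b + n) + (a - b)`; last `(a+1)ₙ₊₁ - (a)ₙ₊₁ =
(n+1)(a+1)ₙ`. -/
theorem regF_contiguous_lower (a b z : ℂ) :
    b * regF a (b + 1) z + z * (a * regF (a + 1) (b + 1 + 1) z) = regF a b z := by
  refine (((hasSum_regF a (b + 1) z).mul_left b).add
    (hasSum_mul_regF_succ a (b + 1) z)).unique ?_
  convert! hasSum_regF a b z using 2 with n
  rw [regTerm, regTerm, inv_Gamma_eq (b + n)]
  ring_nf

theorem regF_contiguous_upper (a b z : ℂ) :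
    a * regF (a + 1) (b + 1) z = regF a b z + (a - b) * regF a (b + 1) z := by
  refine HasSum.unique ((hasSum_regF (a + 1) (b + 1) z).mul_left a) ?_
  convert! (hasSum_regF a b z).add ((hasSum_regF a (b + 1) z).mul_left (a - b)) using 2 with n
  have h := ascPochhammer_succ_eval_left n a
  rw [ascPochhammer_succ_eval] at h
  simp only [regTerm]
  rw [inv_Gamma_eq (b + n), ← mul_assoc, ← mul_assoc, ← mul_assoc, ← h]
  ring_nf

theorem regF_contiguous_step (a b z : ℂ) :
    regF (a + 1) b z = z * regF (a + 1) (b + 1) z + regF a b z := by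
  have h : HasSum (fun n => regTerm n (a + 1) b z - regTerm n a b z)
      (z * regF (a + 1) (b + 1) z) := by
    have h0 : regTerm 0 (a + 1) b z - regTerm 0 a b z = 0 := by simp [regTerm]
    rw [← hasSum_nat_add_iff' 1, Finset.range_one, Finset.sum_singleton, h0, sub_zero]
    convert! (hasSum_regF (a + 1) (b + 1) z).mul_left z using 2 with n
    rw [regTerm, regTerm, regTerm, ascPochhammer_succ_eval_left n a, ascPochhammer_succ_eval,
      inv_factorial_eq n]
    push_cast
    ring_nf
  rw [← ((hasSum_regF (a + 1) b z).sub (hasSum_regF a b z)).unique h]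
  ring

theorem inv_Gamma_eq_ascPochhammer_mul (a : ℂ) (k : ℕ) :
    (Complex.Gamma a)⁻¹ = (ascPochhammer ℂ k).eval a * (Complex.Gamma (a + k))⁻¹ := by
  induction k with
  | zero => simp
  | succ k ih =>
    rw [ih, ascPochhammer_succ_eval, inv_Gamma_eq (a + k)]
    push_cast
    ring_nf

theorem ascPochhammer_add_eval (a : ℂ) (k n : ℕ) : (ascPochhammer ℂ (k + n)).eval a =
    (ascPochhammer ℂ k).eval a * (ascPochhammer ℂ n).eval (a + k) := by
  rw [← ascPochhammer_mul]
  simp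

/-- The first `k` coefficients vanish, since `1/Γ` is zero at non-positive integers; the series
restarts at `n = k`. -/
theorem regF_one_sub_nat (a z : ℂ) (k : ℕ) :
    regF a (1 - k) z = (ascPochhammer ℂ k).eval a * z ^ k * regF (a + k) (1 + k) z := by
  refine (hasSum_regF a (1 - k) z).unique ?_
  rw [← hasSum_nat_add_iff' k, Finset.sum_eq_zero, sub_zero]
  · convert! (hasSum_regF (a + k) (1 + k) z).mul_left
      ((ascPochhammer ℂ k).eval a * z ^ k) using 2 with n
    rw [regTerm, regTerm, add_comm n k, ascPochhammer_add_eval,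
      show (1 : ℂ) - k + ((k + n : ℕ) : ℂ) = (n : ℂ) + 1 by push_cast; ring,
      show (1 : ℂ) + k + (n : ℂ) = ((k + n : ℕ) : ℂ) + 1 by push_cast; ring,
      Complex.Gamma_nat_eq_factorial, Complex.Gamma_nat_eq_factorial]
    ring
  · intro n hn
    rw [Finset.mem_range] at hn
    have : Complex.Gamma (1 - k + n) = 0 := by
      rw [show (1 : ℂ) - k + n = -((k - 1 - n : ℕ) : ℂ) by
        rw [Nat.sub_sub, Nat.cast_sub (by omega)]; push_cast; ring]
      exact Complex.Gamma_neg_nat_eq_zero _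
    simp [regTerm, this]

theorem continuous_regF_comp {X : Type*} [TopologicalSpace X] {f g h : X → ℂ} (hf : Continuous f)
    (hg : Continuous g) (hh : Continuous h) : Continuous fun x => regF (f x) (g x) (h x) := by
  have h1 : Continuous fun x => (f x, g x, h x) := hf.prodMk (hg.prodMk hh)
  have h2 := continuous_regF.comp h1
  exact h2

/-- Kummer's differential equation, written without second derivatives; it yields the second
equation of the first-order system. -/
theorem mul_regF_add_two (a b z : ℂ) :
    z * ((1 + a) * regF (1 + a + 1) (1 + b + 1) z) =
      (z - b) * regF (1 + a) (1 + b) z + regF a b z := by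
  have h1 := regF_contiguous_lower (a + 1) b z
  have h2 := regF_contiguous_step a b z
  rw [add_comm 1 a, add_comm 1 b]
  linear_combination h1 + h2

theorem hasDerivAt_regF_exp (a b ζ : ℂ) :
    HasDerivAt (fun ζ => regF a b (Complex.exp ζ))
      (a * Complex.exp ζ * regF (1 + a) (1 + b) (Complex.exp ζ)) ζ := by
  refine ((hasDerivAt_regF a b (Complex.exp ζ)).comp ζ (Complex.hasDerivAt_exp ζ)).congr_deriv ?_
  rw [add_comm 1 a, add_comm 1 b]
  ring

theorem hasDerivAt_regF_succ_exp (a b ζ : ℂ) :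
    HasDerivAt (fun ζ => regF (1 + a) (1 + b) (Complex.exp ζ))
      ((Complex.exp ζ - b) * regF (1 + a) (1 + b) (Complex.exp ζ) + regF a b (Complex.exp ζ)) ζ := by
  refine ((hasDerivAt_regF (1 + a) (1 + b) (Complex.exp ζ)).comp ζ
    (Complex.hasDerivAt_exp ζ)).congr_deriv ?_
  rw [← mul_regF_add_two]
  ring

/-- The left side times `exp (-z)` has zero derivative by the contiguous relations. The factor
`z^(-b)` of the true Wronskian is stripped off, so everything is entire and the constant can be read
at `z = 0`. -/
theorem regF_wronskian (a b z : ℂ) :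
    regF a b z * regF (1 + a - b) (1 - b) z -
      a * (z * regF (1 + a - b) (2 - b) z) * regF (1 + a) (1 + b) z =
      (Complex.Gamma b)⁻¹ * (Complex.Gamma (1 - b))⁻¹ * Complex.exp z := by
  set w : ℂ → ℂ := fun z => (regF a b z * regF (1 + a - b) (1 - b) z -
      a * (z * regF (1 + a - b) (2 - b) z) * regF (1 + a) (1 + b) z) * Complex.exp (-z) with hw
  have hd : ∀ z, HasDerivAt w 0 z := by
    intro z
    have h := ((((hasDerivAt_regF a b z).mul (hasDerivAt_regF (1 + a - b) (1 - b) z)).sub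
      ((((hasDerivAt_id z).mul (hasDerivAt_regF (1 + a - b) (2 - b) z)).const_mul a).mul
        (hasDerivAt_regF (1 + a) (1 + b) z))).mul (hasDerivAt_neg z).cexp)
    refine h.congr_deriv ?_
    have e1 := regF_contiguous_upper (1 + a - b) (1 - b) z
    have e2 := regF_contiguous_lower (1 + a - b) (1 - b) z
    have e3 := mul_regF_add_two a b z
    rw [show (1 : ℂ) - b + 1 = 2 - b by ring] at e1 e2 ⊢
    simp only [id, Pi.mul_apply, Pi.sub_apply]
    rw [add_comm a 1, add_comm b 1]
    linear_combination Complex.exp (-z) * (regF a b z * e1 - a * regF (1 + a) (1 + b) z * e2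
      - a * regF (1 + a - b) (2 - b) z * e3)
  have hc : w z = w 0 :=
    is_const_of_deriv_eq_zero (fun z => (hd z).differentiableAt) (fun z => (hd z).deriv) z 0
  have h0 : ∀ a b, regF a b 0 = (Complex.Gamma b)⁻¹ := by
    intro a b
    rw [regF_eq_tsum, tsum_eq_single 0 (fun n hn => by simp [regTerm, hn])]
    simp [regTerm]
  have hw0 : w 0 = (Complex.Gamma b)⁻¹ * (Complex.Gamma (1 - b))⁻¹ := by
    simp only [hw, h0]
    simp
  rw [← hw0, ← hc, hw]
  dsimp only
  rw [mul_assoc _ (Complex.exp (-z)), ← Complex.exp_add]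
  simp

/-! ### The second Kummer function away from integer `b` -/

theorem kummerUGeneric_succ (a b ζ : ℂ) : kummerUGeneric (1 + a) (1 + b) ζ =
    -(Real.pi / Complex.sin (Real.pi * b)) *
      (regF (1 + a) (1 + b) (Complex.exp ζ) / Complex.Gamma (1 + a - b) -
        Complex.exp (-b * ζ) * regF (1 + a - b) (1 - b) (Complex.exp ζ) /
          Complex.Gamma (1 + a)) := by
  rw [kummerUGeneric, mul_add, mul_one, add_comm (Real.pi : ℂ), Complex.sin_add_pi, div_neg,
    show (1 : ℂ) + (1 + a) - (1 + b) = 1 + a - b by ring, show (2 : ℂ) - (1 + b) = 1 - b by ring,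
    show (1 : ℂ) - (1 + b) = -b by ring]

/-- With `hasDerivAt_kummerUGeneric_succ`, this says that `(U⁽⁰⁾, U⁽¹⁾)` solves the first-order
system. The part carrying `z^(1-b)` is handled by the contiguous relations at parameters `1 + a -
b`, `1 - b`. -/
theorem hasDerivAt_kummerUGeneric (a b ζ : ℂ) :
    HasDerivAt (kummerUGeneric a b)
      (-a * Complex.exp ζ * kummerUGeneric (1 + a) (1 + b) ζ) ζ := by
  have h := (((hasDerivAt_regF_exp a b ζ).div_const (Complex.Gamma (1 + a - b))).sub
    ((((hasDerivAt_id ζ).const_mul (1 - b)).cexp.mul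
      (hasDerivAt_regF_exp (1 + a - b) (2 - b) ζ)).div_const (Complex.Gamma a))).const_mul
      (Real.pi / Complex.sin (Real.pi * b))
  refine h.congr_deriv ?_
  have e2 := regF_contiguous_lower (1 + a - b) (1 - b) (Complex.exp ζ)
  have hG := inv_Gamma_eq a
  have hexp : Complex.exp ((1 - b) * ζ) = Complex.exp ζ * Complex.exp (-b * ζ) := by
    rw [← Complex.exp_add]; ring_nf
  rw [kummerUGeneric_succ]
  simp only [id, div_eq_mul_inv]
  rw [hG, hexp, add_comm 1 (1 + a - b), add_comm 1 (2 - b), add_comm 1 a]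
  rw [show (1 : ℂ) - b + 1 = 2 - b by ring, add_comm 1 a] at e2
  linear_combination -((Real.pi : ℂ) * (Complex.sin (Real.pi * b))⁻¹ * Complex.exp ζ *
    Complex.exp (-b * ζ) * a * (Complex.Gamma (a + 1))⁻¹) * e2

theorem hasDerivAt_kummerUGeneric_succ (a b ζ : ℂ) :
    HasDerivAt (kummerUGeneric (1 + a) (1 + b))
      ((Complex.exp ζ - b) * kummerUGeneric (1 + a) (1 + b) ζ - kummerUGeneric a b ζ) ζ := by
  have h := (((hasDerivAt_regF_succ_exp a b ζ).div_const (Complex.Gamma (1 + a - b))).sub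
    ((((hasDerivAt_id ζ).const_mul (-b)).cexp.mul
      (hasDerivAt_regF_exp (1 + a - b) (1 - b) ζ)).div_const (Complex.Gamma (1 + a)))).const_mul
      (-(Real.pi / Complex.sin (Real.pi * b)))
  rw [funext (kummerUGeneric_succ a b)]
  refine h.congr_deriv ?_
  have e1 := regF_contiguous_upper (1 + a - b) (1 - b) (Complex.exp ζ)
  have hG := inv_Gamma_eq a
  have hexp : Complex.exp ((1 - b) * ζ) = Complex.exp ζ * Complex.exp (-b * ζ) := by
    rw [← Complex.exp_add]; ring_nf
  rw [kummerUGeneric]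
  simp only [id, div_eq_mul_inv]
  rw [hG, hexp, add_comm 1 (1 + a - b), add_comm 1 (1 - b), add_comm 1 a]
  rw [show (1 : ℂ) - b + 1 = 2 - b by ring, add_comm 1 a] at e1
  rw [show (1 : ℂ) - b + 1 = 2 - b by ring]
  linear_combination ((Real.pi : ℂ) * (Complex.sin (Real.pi * b))⁻¹ * Complex.exp ζ *
    Complex.exp (-b * ζ) * (Complex.Gamma (a + 1))⁻¹) * e1

theorem kummerUGeneric_wronskian (a b ζ : ℂ) (hb : Complex.sin (Real.pi * b) ≠ 0) :
    regF a b (Complex.exp ζ) * kummerUGeneric (1 + a) (1 + b) ζ +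
      kummerUGeneric a b ζ * regF (1 + a) (1 + b) (Complex.exp ζ) =
      Complex.exp (Complex.exp ζ - b * ζ) * (Complex.Gamma (1 + a))⁻¹ := by
  have hw := regF_wronskian a b (Complex.exp ζ)
  have hG := inv_Gamma_eq a
  have hexp : Complex.exp ((1 - b) * ζ) = Complex.exp ζ * Complex.exp (-b * ζ) := by
    rw [← Complex.exp_add]; ring_nf
  -- Euler's reflection formula: the prefactor of `U` cancels the Gamma factors of `regF_wronskian`.
  have hr : (Real.pi : ℂ) * (Complex.sin (Real.pi * b))⁻¹ *
      ((Complex.Gamma b)⁻¹ * (Complex.Gamma (1 - b))⁻¹) = 1 := by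
    rw [← mul_inv, Complex.Gamma_mul_Gamma_one_sub]
    have : (Real.pi : ℂ) ≠ 0 := by exact_mod_cast Real.pi_ne_zero
    field_simp
  rw [sub_eq_add_neg, Complex.exp_add, ← neg_mul, kummerUGeneric_succ, kummerUGeneric]
  simp only [div_eq_mul_inv]
  rw [hG, hexp, add_comm a 1]
  linear_combination ((Real.pi : ℂ) * (Complex.sin (Real.pi * b))⁻¹ *
    Complex.exp (-b * ζ) * (Complex.Gamma (1 + a))⁻¹) * hw + Complex.exp (Complex.exp ζ) *
    Complex.exp (-b * ζ) * (Complex.Gamma (1 + a))⁻¹ * hr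

/-! ### Passage to the limit at integer `b` -/

theorem sin_pi_mul_one_add (b : ℂ) :
    Complex.sin (Real.pi * (1 + b)) = -Complex.sin (Real.pi * b) := by
  rw [mul_add, mul_one, add_comm, Complex.sin_add_pi]

/-- The bracket in the definition of `kummerUGeneric`. -/
def kummerUBracket (a b ζ : ℂ) : ℂ :=
  regF a b (Complex.exp ζ) / Complex.Gamma (1 + a - b)
      - Complex.exp ((1 - b) * ζ) * regF (1 + a - b) (2 - b) (Complex.exp ζ) / Complex.Gamma a

theorem kummerUGeneric_eq (a b ζ : ℂ) : kummerUGeneric a b ζ =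
    Real.pi / Complex.sin (Real.pi * b) * kummerUBracket a b ζ := rfl

theorem differentiable_kummerUBracket (a ζ : ℂ) :
    Differentiable ℂ fun b => kummerUBracket a b ζ := by
  unfold kummerUBracket
  have h1 : Differentiable ℂ fun b => regF a b (Complex.exp ζ) :=
    differentiable_regF_comp (differentiable_const _) differentiable_id (differentiable_const _)
  have h2 : Differentiable ℂ fun b => regF (1 + a - b) (2 - b) (Complex.exp ζ) :=
    differentiable_regF_comp (differentiable_id.const_sub _) (differentiable_id.const_sub _)
      (differentiable_const _)
  have h3 : Differentiable ℂ fun b => (Complex.Gamma (1 + a - b))⁻¹ :=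
    Complex.differentiable_one_div_Gamma.comp (differentiable_id.const_sub _)
  simp only [div_eq_mul_inv]
  fun_prop

theorem differentiableAt_kummerUGeneric (a ζ : ℂ) {b : ℂ} (hb : Complex.sin (Real.pi * b) ≠ 0) :
    DifferentiableAt ℂ (fun b => kummerUGeneric a b ζ) b := by
  simp only [kummerUGeneric_eq]
  have := differentiable_kummerUBracket a ζ b
  have h2 : DifferentiableAt ℂ (fun b : ℂ => Complex.sin (Real.pi * b)) b := by fun_prop
  exact ((differentiableAt_const _).div h2 hb).mul this

theorem continuousOn_kummerUGeneric (a : ℂ) :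
    ContinuousOn (fun p : ℂ × ℂ => kummerUGeneric a p.1 p.2)
      {p | Complex.sin (Real.pi * p.1) ≠ 0} := by
  simp only [kummerUGeneric_eq, kummerUBracket, div_eq_mul_inv]
  have h1 : Continuous fun p : ℂ × ℂ => regF a p.1 (Complex.exp p.2) :=
    continuous_regF_comp (by fun_prop) (by fun_prop) (by fun_prop)
  have h2 : Continuous fun p : ℂ × ℂ => regF (1 + a - p.1) (2 - p.1) (Complex.exp p.2) :=
    continuous_regF_comp (by fun_prop) (by fun_prop) (by fun_prop)
  have h3 : Continuous fun p : ℂ × ℂ => (Complex.Gamma (1 + a - p.1))⁻¹ :=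
    Complex.differentiable_one_div_Gamma.continuous.comp
      (by fun_prop : Continuous fun p : ℂ × ℂ => 1 + a - p.1)
  have h4 : ContinuousOn (fun p : ℂ × ℂ => (Complex.sin (Real.pi * p.1))⁻¹)
      {p | Complex.sin (Real.pi * p.1) ≠ 0} :=
    ContinuousOn.inv₀ (by fun_prop) fun p hp => hp
  refine (continuousOn_const.mul h4).mul (Continuous.continuousOn ?_)
  fun_prop

/-- At `b = 1 + k` the two Kummer solutions become proportional by `regF_one_sub_nat`, and the Gamma
factors make the two terms cancel. -/
theorem kummerUBracket_one_add_nat (a ζ : ℂ) (k : ℕ) : kummerUBracket a (1 + k) ζ = 0 := by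
  rw [kummerUBracket, show (1 : ℂ) + a - (1 + k) = a - k by ring,
    show (2 : ℂ) - (1 + k) = 1 - k by ring, regF_one_sub_nat, show a - k + (k : ℂ) = a by ring,
    div_eq_mul_inv, inv_Gamma_eq_ascPochhammer_mul (a - k) k, show a - k + (k : ℂ) = a by ring,
    ← Complex.exp_nat_mul]
  have : Complex.exp ((1 - (1 + (k : ℂ))) * ζ) * Complex.exp (k * ζ) = 1 := by
    rw [← Complex.exp_add, ← Complex.exp_zero]; ring_nf
  linear_combination -((ascPochhammer ℂ k).eval (a - k) * regF a (1 + k) (Complex.exp ζ) *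
    (Complex.Gamma a)⁻¹) * this

theorem hasDerivAt_sin_pi_mul (b : ℂ) : HasDerivAt (fun b : ℂ => Complex.sin (Real.pi * b))
    (Complex.cos (Real.pi * b) * Real.pi) b := by
  simpa using ((hasDerivAt_id b).const_mul (Real.pi : ℂ)).csin

theorem cos_mul_pi_ne_zero {b : ℂ} (hb : Complex.sin (Real.pi * b) = 0) :
    Complex.cos (Real.pi * b) * Real.pi ≠ 0 := by
  have h := Complex.sin_sq_add_cos_sq (Real.pi * b)
  refine mul_ne_zero (fun h0 => ?_) (by exact_mod_cast Real.pi_ne_zero)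
  simp [hb, h0] at h

/-- Shows that the limit defining `kummerU` exists. At a positive integer both bracket and sine
vanish, the sine to first order only, so the ratio of their difference quotients converges; at a
non-integer plain continuity suffices. -/
theorem tendsto_kummerUGeneric (a ζ : ℂ) {b : ℂ} (hb : ∀ n : ℕ, b ≠ -n) :
    Tendsto (fun b' => kummerUGeneric a b' ζ) (𝓝[≠] b) (𝓝 (kummerU a b ζ)) := by
  refine tendsto_nhds_limUnder ?_
  by_cases hs : Complex.sin (Real.pi * b) = 0
  · obtain ⟨k, hk⟩ := Complex.sin_eq_zero_iff.1 hs
    have hbk : b = k := by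
      rw [mul_comm] at hk
      exact mul_right_cancel₀ (by exact_mod_cast Real.pi_ne_zero) hk
    obtain ⟨m, rfl⟩ : ∃ m : ℕ, k = 1 + m := by
      rcases lt_or_ge 0 k with h | h
      · exact ⟨(k - 1).toNat, by omega⟩
      · refine absurd ?_ (hb (-k).toNat)
        rw [hbk, ← Int.cast_natCast, Int.toNat_of_nonneg (by omega)]
        simp
    have hG : kummerUBracket a b ζ = 0 := by
      rw [hbk]; push_cast; exact kummerUBracket_one_add_nat a ζ m
    have h1 := hasDerivAt_iff_tendsto_slope.1 (differentiable_kummerUBracket a ζ b).hasDerivAt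
    have h2 := hasDerivAt_iff_tendsto_slope.1 (hasDerivAt_sin_pi_mul b)
    refine ⟨_, ((h1.div h2 (cos_mul_pi_ne_zero hs)).const_mul (Real.pi : ℂ)).congr' ?_⟩
    filter_upwards [self_mem_nhdsWithin] with b' hb'
    have : b' - b ≠ 0 := sub_ne_zero.2 hb'
    simp only [Pi.div_apply, slope_def_field, hG, hs, sub_zero, kummerUGeneric_eq]
    rw [div_div_div_cancel_right₀ this]
    ring
  · exact ⟨_, (differentiableAt_kummerUGeneric a ζ hs).continuousAt.tendsto.mono_left
      nhdsWithin_le_nhds⟩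

theorem exists_closedBall_sin_ne_zero (b : ℂ) : ∃ R : ℝ, 0 < R ∧
    ∀ w ∈ Metric.closedBall b R, w ≠ b → Complex.sin (Real.pi * w) ≠ 0 := by
  have h : ∀ᶠ w in 𝓝[≠] b, Complex.sin (Real.pi * w) ≠ 0 := by
    by_cases hs : Complex.sin (Real.pi * b) = 0
    · exact (hasDerivAt_sin_pi_mul b).eventually_ne (cos_mul_pi_ne_zero hs)
    · exact ((hasDerivAt_sin_pi_mul b).continuousAt.eventually_ne hs).filter_mono
        nhdsWithin_le_nhds
  rw [eventually_nhdsWithin_iff, Metric.nhds_basis_closedBall.eventually_iff] at h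
  obtain ⟨R, hR, h⟩ := h
  exact ⟨R, hR, fun w hw hne => h hw hne⟩

/-- The mean value property, applied after filling the removable singularity with `L`. -/
theorem circleAverage_eq_of_tendsto {f : ℂ → ℂ} {c L : ℂ} {R : ℝ} (hR : 0 < R)
    (hd : ∀ w ∈ Metric.closedBall c R, w ≠ c → DifferentiableAt ℂ f w)
    (ht : Tendsto f (𝓝[≠] c) (𝓝 L)) : Real.circleAverage f c R = L := by
  have heq : ∀ w, w ≠ c → Function.update f c L =ᶠ[𝓝 w] f := fun w hw => by
    filter_upwards [isOpen_ne.mem_nhds hw] with x hx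
    exact Function.update_of_ne hx _ _
  have hdiff : ∀ w ∈ Metric.closedBall c R, w ≠ c →
      DifferentiableAt ℂ (Function.update f c L) w :=
    fun w hw hne => (hd w hw hne).congr_of_eventuallyEq (heq w hne)
  have hm := circleAverage_of_differentiable_on_off_countable (f := Function.update f c L)
    (R := R) (countable_singleton c) (c := c) ?_ ?_
  · rw [Function.update_self] at hm
    rw [← hm]
    refine Real.circleAverage_congr_sphere fun w hw => ?_
    refine (Function.update_of_ne ?_ _ _).symm
    rw [abs_of_pos hR] at hw
    exact Metric.ne_of_mem_sphere hw hR.ne'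
  · intro w hw
    rw [abs_of_pos hR] at hw
    rcases eq_or_ne w c with rfl | hne
    · exact (continuousAt_update_same.2 ht).continuousWithinAt
    · exact (hdiff w hw hne).continuousAt.continuousWithinAt
  · intro w hw
    rw [abs_of_pos hR] at hw
    exact hdiff w (Metric.ball_subset_closedBall hw.1) hw.2

theorem hasDerivAt_circleAverage {f f' : ℂ → ℂ → ℂ} {c : ℂ} {R : ℝ} (hR : 0 < R)
    (hd : ∀ w ∈ Metric.sphere c R, ∀ ζ, HasDerivAt (f w) (f' w ζ) ζ)
    (hc : ∀ ζ, ContinuousOn (fun w => f w ζ) (Metric.sphere c R))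
    (hc' : ContinuousOn (fun p : ℂ × ℂ => f' p.1 p.2) (Metric.sphere c R ×ˢ univ)) (ζ : ℂ) :
    HasDerivAt (fun ζ => Real.circleAverage (fun w => f w ζ) c R)
      (Real.circleAverage (fun w => f' w ζ) c R) ζ := by
  have hm : ∀ t, circleMap c R t ∈ Metric.sphere c R := circleMap_mem_sphere c hR.le
  have h1 : ∀ ζ, Continuous fun t => f (circleMap c R t) ζ := fun ζ =>
    (hc ζ).comp_continuous (continuous_circleMap c R) hm
  have h2 : Continuous fun p : ℂ × ℝ => f' (circleMap c R p.2) p.1 :=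
    hc'.comp_continuous (f := fun p : ℂ × ℝ => (circleMap c R p.2, p.1))
      (((continuous_circleMap c R).comp continuous_snd).prodMk continuous_fst)
      fun p => ⟨hm _, mem_univ _⟩
  obtain ⟨C, hC⟩ := ((isCompact_closedBall ζ 1).prod
    (isCompact_uIcc (a := (0 : ℝ)) (b := 2 * Real.pi))).exists_bound_of_continuousOn h2.continuousOn
  have := (intervalIntegral.hasDerivAt_integral_of_dominated_loc_of_deriv_le
    (μ := MeasureTheory.volume) (a := 0) (b := 2 * Real.pi) (bound := fun _ => C)
    (F := fun ζ t => f (circleMap c R t) ζ) (F' := fun ζ t => f' (circleMap c R t) ζ)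
    (Metric.closedBall_mem_nhds ζ one_pos)
    (Eventually.of_forall fun ζ => (h1 ζ).aestronglyMeasurable)
    ((h1 ζ).intervalIntegrable _ _)
    ((h2.comp (Continuous.prodMk_right ζ)).aestronglyMeasurable)
    (Eventually.of_forall fun t ht x hx => hC (x, t) ⟨hx, uIoc_subset_uIcc ht⟩)
    intervalIntegrable_const
    (Eventually.of_forall fun t _ x _ => hd _ (hm t) x)).2
  exact this.const_smul _

/-- Differentiation of a family depending holomorphically on a parameter `w` passes to the limit
at a removable singularity `w = c`. -/
theorem hasDerivAt_of_tendsto_parameter {f f' : ℂ → ℂ → ℂ} {g g' : ℂ → ℂ} {c : ℂ} {s : Set ℂ}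
    {R : ℝ} (hR : 0 < R) (hs : ∀ w ∈ Metric.closedBall c R, w ≠ c → w ∈ s)
    (hd : ∀ w ∈ s, ∀ ζ, HasDerivAt (f w) (f' w ζ) ζ)
    (hf : ∀ w ∈ s, ∀ ζ, DifferentiableAt ℂ (fun w => f w ζ) w)
    (hf' : ∀ w ∈ s, ∀ ζ, DifferentiableAt ℂ (fun w => f' w ζ) w)
    (hc' : ContinuousOn (fun p : ℂ × ℂ => f' p.1 p.2) (s ×ˢ univ))
    (ht : ∀ ζ, Tendsto (fun w => f w ζ) (𝓝[≠] c) (𝓝 (g ζ)))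
    (ht' : ∀ ζ, Tendsto (fun w => f' w ζ) (𝓝[≠] c) (𝓝 (g' ζ))) (ζ : ℂ) :
    HasDerivAt g (g' ζ) ζ := by
  have hsph : Metric.sphere c R ⊆ s := fun w hw =>
    hs w (Metric.sphere_subset_closedBall hw) (Metric.ne_of_mem_sphere hw hR.ne')
  -- By the mean value property `g` and `g'` are averages of `f` and `f'` over a circle avoiding
  -- `c`. Differentiating under the integral therefore needs no uniformity in `ζ` of the limit `w →
  -- c`.
  have h := hasDerivAt_circleAverage hR (fun w hw => hd w (hsph hw))
    (fun ζ w hw => (hf w (hsph hw) ζ).continuousAt.continuousWithinAt)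
    (hc'.mono (prod_mono_left hsph)) ζ
  rw [circleAverage_eq_of_tendsto hR (fun w hw hne => hf' w (hs w hw hne) ζ) (ht' ζ)] at h
  rwa [funext fun ζ => circleAverage_eq_of_tendsto hR (fun w hw hne => hf w (hs w hw hne) ζ)
    (ht ζ)] at h

theorem one_add_ne_neg_nat {b : ℂ} (hb : ∀ n : ℕ, b ≠ -n) (n : ℕ) : 1 + b ≠ -n := fun h =>
  hb (n + 1) (by push_cast; linear_combination h)

theorem tendsto_kummerUGeneric_succ (a ζ : ℂ) {b : ℂ} (hb : ∀ n : ℕ, b ≠ -n) :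
    Tendsto (fun b' => kummerUGeneric (1 + a) (1 + b') ζ) (𝓝[≠] b)
      (𝓝 (kummerU (1 + a) (1 + b) ζ)) := by
  refine (tendsto_kummerUGeneric (1 + a) ζ (one_add_ne_neg_nat hb)).comp
    (tendsto_nhdsWithin_iff.2 ⟨?_, ?_⟩)
  · exact ((continuous_const.add continuous_id).tendsto b).mono_left nhdsWithin_le_nhds
  · filter_upwards [self_mem_nhdsWithin] with w hw
    simpa using hw

theorem differentiableAt_kummerUGeneric_succ (a ζ : ℂ) {b : ℂ}
    (hb : Complex.sin (Real.pi * b) ≠ 0) :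
    DifferentiableAt ℂ (fun b => kummerUGeneric (1 + a) (1 + b) ζ) b :=
  (differentiableAt_kummerUGeneric (1 + a) ζ (b := 1 + b)
    (by rwa [sin_pi_mul_one_add, neg_ne_zero])).comp b (differentiableAt_id.const_add _)

theorem continuousOn_kummerUGeneric_succ (a : ℂ) :
    ContinuousOn (fun p : ℂ × ℂ => kummerUGeneric (1 + a) (1 + p.1) p.2)
      {p | Complex.sin (Real.pi * p.1) ≠ 0} :=
  (continuousOn_kummerUGeneric (1 + a)).comp (f := fun p : ℂ × ℂ => (1 + p.1, p.2))
    (by fun_prop) fun p (hp : _ ≠ _) => by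
      simpa only [mem_ofPred_eq, sin_pi_mul_one_add, ne_eq, neg_eq_zero] using hp

theorem hasDerivAt_kummerU (a : ℂ) {b : ℂ} (hb : ∀ n : ℕ, b ≠ -n) (ζ : ℂ) :
    HasDerivAt (kummerU a b) (-a * Complex.exp ζ * kummerU (1 + a) (1 + b) ζ) ζ := by
  obtain ⟨R, hR, hs⟩ := exists_closedBall_sin_ne_zero b
  refine hasDerivAt_of_tendsto_parameter (s := {w | Complex.sin (Real.pi * w) ≠ 0})
    (g' := fun ζ => -a * Complex.exp ζ * kummerU (1 + a) (1 + b) ζ) hR hs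
    (fun w _ => hasDerivAt_kummerUGeneric a w)
    (fun w hw ζ => differentiableAt_kummerUGeneric a ζ hw)
    (fun w hw ζ => (differentiableAt_kummerUGeneric_succ a ζ hw).const_mul _) ?_
    (fun ζ => tendsto_kummerUGeneric a ζ hb)
    (fun ζ => (tendsto_kummerUGeneric_succ a ζ hb).const_mul _) ζ
  exact ContinuousOn.mul (by fun_prop)
    ((continuousOn_kummerUGeneric_succ a).mono fun p hp => hp.1)

theorem hasDerivAt_kummerU_succ (a : ℂ) {b : ℂ} (hb : ∀ n : ℕ, b ≠ -n) (ζ : ℂ) :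
    HasDerivAt (kummerU (1 + a) (1 + b))
      ((Complex.exp ζ - b) * kummerU (1 + a) (1 + b) ζ - kummerU a b ζ) ζ := by
  obtain ⟨R, hR, hs⟩ := exists_closedBall_sin_ne_zero b
  refine hasDerivAt_of_tendsto_parameter (s := {w | Complex.sin (Real.pi * w) ≠ 0})
    (g' := fun ζ => (Complex.exp ζ - b) * kummerU (1 + a) (1 + b) ζ - kummerU a b ζ) hR hs
    (fun w _ => hasDerivAt_kummerUGeneric_succ a w)
    (fun w hw ζ => differentiableAt_kummerUGeneric_succ a ζ hw)
    (fun w hw ζ => ((differentiableAt_id.const_sub _).mul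
      (differentiableAt_kummerUGeneric_succ a ζ hw)).sub
      (differentiableAt_kummerUGeneric a ζ hw)) ?_
    (fun ζ => tendsto_kummerUGeneric_succ a ζ hb)
    (fun ζ => (Tendsto.mul ?_ (tendsto_kummerUGeneric_succ a ζ hb)).sub
      (tendsto_kummerUGeneric a ζ hb)) ζ
  · exact (ContinuousOn.mul (by fun_prop)
      ((continuousOn_kummerUGeneric_succ a).mono fun p hp => hp.1)).sub
      ((continuousOn_kummerUGeneric a).mono fun p hp => hp.1)
  · exact ((continuous_const.sub continuous_id).tendsto b).mono_left nhdsWithin_le_nhds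

theorem kummerU_wronskian (a ζ : ℂ) {b : ℂ} (hb : ∀ n : ℕ, b ≠ -n) :
    regF a b (Complex.exp ζ) * kummerU (1 + a) (1 + b) ζ +
      kummerU a b ζ * regF (1 + a) (1 + b) (Complex.exp ζ) =
      Complex.exp (Complex.exp ζ - b * ζ) * (Complex.Gamma (1 + a))⁻¹ := by
  obtain ⟨R, hR, hs⟩ := exists_closedBall_sin_ne_zero b
  have hF : ∀ {f : ℂ → ℂ}, Continuous f → Tendsto f (𝓝[≠] b) (𝓝 (f b)) := fun hf =>
    (hf.tendsto b).mono_left nhdsWithin_le_nhds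
  have h1 : Continuous fun w => regF a w (Complex.exp ζ) :=
    continuous_regF_comp (by fun_prop) (by fun_prop) (by fun_prop)
  have h2 : Continuous fun w => regF (1 + a) (1 + w) (Complex.exp ζ) :=
    continuous_regF_comp (by fun_prop) (by fun_prop) (by fun_prop)
  have h3 : Continuous fun w : ℂ => Complex.exp (Complex.exp ζ - w * ζ) *
    (Complex.Gamma (1 + a))⁻¹ := by fun_prop
  refine tendsto_nhds_unique (((hF h1).mul (tendsto_kummerUGeneric_succ a ζ hb)).add
    ((tendsto_kummerUGeneric a ζ hb).mul (hF h2))) ((hF h3).congr' ?_)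
  filter_upwards [self_mem_nhdsWithin, nhdsWithin_le_nhds (Metric.closedBall_mem_nhds b hR)]
    with w hw hw'
  exact (kummerUGeneric_wronskian a w ζ (hs w hw' hw)).symm

/-! ### From the Kummer system to the evolution equation -/

theorem kummerF_eq (a b z : ℂ) : kummerF a b z = Complex.Gamma b * regF a b z := rfl

theorem kummerF_succ_div (a z : ℂ) {b : ℂ} (hb : b ≠ 0) :
    kummerF (1 + a) (1 + b) z / b = Complex.Gamma b * regF (1 + a) (1 + b) z := by
  rw [kummerF_eq, add_comm 1 b, Complex.Gamma_add_one b hb]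
  field_simp

theorem IsEvolution.linear_combination {g₀ ρ ω θi : ℝ} {ψ φ : ℝ → Fin 2 → ℂ}
    (hψ : IsEvolution g₀ ρ ω θi ψ) (hφ : IsEvolution g₀ ρ ω θi φ) (u v : ℂ) :
    IsEvolution g₀ ρ ω θi fun t => u • ψ t + v • φ t := by
  intro t
  refine (((hψ t).const_smul u).add ((hφ t).const_smul v)).congr_deriv ?_
  rw [Matrix.mulVec_add, Matrix.mulVec_smul, Matrix.mulVec_smul, smul_add, smul_comm u, smul_comm v]

theorem hamiltonian_mulVec (g₀ ρ ω θi t : ℝ) (x : Fin 2 → ℂ) :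
    -Complex.I • (hamiltonian g₀ ρ ω θi t).mulVec x =
      ![(g₀ - ρ * Complex.exp (Complex.I * (ω * t + θi))) * x 0 - Complex.I * x 1,
        -Complex.I * x 0 - (g₀ - ρ * Complex.exp (Complex.I * (ω * t + θi))) * x 1] := by
  ext i
  fin_cases i
  · simp [hamiltonian, dotProduct, Fin.sum_univ_two]
    linear_combination -((g₀ - ρ * Complex.exp (Complex.I * (ω * t + θi))) * x 0) * Complex.I_sq
  · simp [hamiltonian, dotProduct, Fin.sum_univ_two]
    linear_combination ((g₀ - ρ * Complex.exp (Complex.I * (ω * t + θi))) * x 1) * Complex.I_sq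

theorem IsEvolution.eq_of_initial {g₀ ρ ω θi : ℝ} {ψ φ : ℝ → Fin 2 → ℂ}
    (hψ : IsEvolution g₀ ρ ω θi ψ) (hφ : IsEvolution g₀ ρ ω θi φ) (h0 : ψ 0 = φ 0) : ψ = φ := by
  -- The exponential has modulus one, so in the sup norm the diagonal entries contribute at most
  -- `|g₀| + |ρ|` and the off-diagonal ones `1`, uniformly in `t`.
  refine ODE_solution_unique_univ
    (v := fun t x => -Complex.I • (hamiltonian g₀ ρ ω θi t).mulVec x) (s := fun _ => univ)
    (K := (|g₀| + |ρ| + 1).toNNReal) (t₀ := 0) (fun t => ?_) (fun t => ⟨hψ t, mem_univ _⟩)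
    (fun t => ⟨hφ t, mem_univ _⟩) h0
  refine (LipschitzWith.of_dist_le_mul fun x y => ?_).lipschitzOnWith
  rw [Real.coe_toNNReal _ (by positivity), dist_eq_norm, dist_eq_norm, ← smul_sub,
    ← Matrix.mulVec_sub, hamiltonian_mulVec]
  generalize x - y = z
  have hexp : ‖Complex.exp (Complex.I * (ω * t + θi))‖ = 1 := by
    rw [show Complex.I * (ω * t + θi : ℂ) = ((ω * t + θi : ℝ) : ℂ) * Complex.I by push_cast; ring]
    exact Complex.norm_exp_ofReal_mul_I _
  have hh : ‖(g₀ : ℂ) - ρ * Complex.exp (Complex.I * (ω * t + θi))‖ ≤ |g₀| + |ρ| := by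
    refine (norm_sub_le _ _).trans ?_
    rw [norm_mul, hexp, Complex.norm_real, Complex.norm_real, mul_one, Real.norm_eq_abs,
      Real.norm_eq_abs]
  have h0 := norm_le_pi_norm z 0
  have h1 := norm_le_pi_norm z 1
  rw [pi_norm_le_iff_of_nonneg (by positivity), Fin.forall_fin_two]
  constructor
  · refine (norm_sub_le _ _).trans ?_
    rw [norm_mul, norm_mul, Complex.norm_I, one_mul, add_mul, one_mul]
    gcongr
  · refine (norm_sub_le _ _).trans ?_
    rw [norm_mul, norm_mul, norm_neg, Complex.norm_I, one_mul, add_mul, one_mul,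
      add_comm ((|g₀| + |ρ|) * ‖z‖)]
    gcongr

/-- A solution of the first order Kummer system in `ζ = log η` gives a solution of the evolution
equation along the loop. -/
theorem isEvolution_of_kummer_system {g₀ ρ ω : ℝ} (hω : ω ≠ 0) {r p₁ p₂ c : ℂ}
    (hr : r ^ 2 = 1 - (g₀ : ℂ) ^ 2) (hp₁ : p₁ = (Complex.I * g₀ + r) / ω)
    (hp₂ : p₂ = 1 + 2 * r / ω) (hp₁0 : p₁ ≠ 0)
    (hc : Complex.exp c = -2 * Complex.I * (ρ / ω)) {X₀ X₁ : ℂ → ℂ}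
    (h0 : ∀ ζ, HasDerivAt X₀ (-p₁ * Complex.exp ζ * X₁ ζ) ζ)
    (h1 : ∀ ζ, HasDerivAt X₁ ((Complex.exp ζ - p₂) * X₁ ζ - X₀ ζ) ζ) (θi : ℝ) :
    IsEvolution g₀ ρ ω θi fun t =>
      Complex.exp (Complex.I * r * t - eta ρ ω (θi + ω * t) / 2) •
        ![X₀ (logEta c (θi + ω * t)) / (ω * p₁),
          -X₀ (logEta c (θi + ω * t)) +
            eta ρ ω (θi + ω * t) * X₁ (logEta c (θi + ω * t))] := by
  intro t
  have hωc : (ω : ℂ) ≠ 0 := by exact_mod_cast hω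
  have hζ : HasDerivAt (fun t : ℝ => logEta c (θi + ω * t)) (Complex.I * ω) t := by
    have h := (((hasDerivAt_id (t : ℂ)).const_mul (ω : ℂ)).const_add (θi : ℂ)).const_mul
      Complex.I |>.const_add c |>.comp_ofReal
    simpa [logEta] using h
  have hη : HasDerivAt (fun t : ℝ => eta ρ ω (θi + ω * t))
      (eta ρ ω (θi + ω * t) * (Complex.I * ω)) t := by
    have h := hζ.cexp
    simpa only [exp_logEta hc] using h
  have hX0 := (h0 (logEta c (θi + ω * t))).comp t hζ
  have hX1 := (h1 (logEta c (θi + ω * t))).comp t hζ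
  rw [exp_logEta hc] at hX0 hX1
  have hlin : HasDerivAt (fun t : ℝ => Complex.I * r * t) (Complex.I * r) t := by
    simpa using ((hasDerivAt_id (t : ℂ)).const_mul (Complex.I * r)).comp_ofReal
  have hE := (hlin.sub (hη.div_const 2)).cexp
  have hηe : (ρ : ℂ) * Complex.exp (Complex.I * (ω * t + θi)) =
      Complex.I * ω / 2 * eta ρ ω (θi + ω * t) := by
    rw [eta]
    push_cast
    rw [add_comm (θi : ℂ)]
    have h := mul_div_cancel₀ (ρ : ℂ) hωc
    linear_combination Complex.exp (Complex.I * (ω * t + θi)) *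
      (ω * (ρ / ω) * Complex.I_sq - h)
  rw [hamiltonian_mulVec, hηe, hasDerivAt_pi, Fin.forall_fin_two]
  have hq : (ω : ℂ) * p₁ = Complex.I * g₀ + r := by rw [hp₁]; field_simp
  have hq2 : (ω : ℂ) * p₂ = ω + 2 * r := by rw [hp₂]; field_simp
  have hq0 : (ω : ℂ) * p₁ ≠ 0 := mul_ne_zero hωc hp₁0
  -- The only use of `r² = 1 - g₀²`; it cancels the `X₀` terms in the second component.
  have hinv : ((ω : ℂ) * p₁)⁻¹ = r - Complex.I * g₀ := by
    refine inv_eq_of_mul_eq_one_right ?_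
    rw [hq]
    linear_combination hr - (g₀ : ℂ) ^ 2 * Complex.I_sq
  constructor
  · refine (hE.mul (hX0.div_const (ω * p₁))).congr_deriv ?_
    simp only [Pi.smul_apply, Matrix.cons_val_zero, Matrix.cons_val_one, smul_eq_mul,
      Function.comp_apply, Pi.sub_apply]
    generalize Complex.exp _ = E
    generalize X₀ _ = x₀
    generalize X₁ _ = x₁
    have hx : x₀ = ω * p₁ * (x₀ / (ω * p₁)) := by field_simp
    have hx1 : -p₁ * eta ρ ω (θi + ω * t) * x₁ * (Complex.I * ω) / (ω * p₁) =
      -eta ρ ω (θi + ω * t) * x₁ * Complex.I := by field_simp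
    rw [hx1]
    linear_combination -(E * Complex.I) * hx - E * (x₀ / (ω * p₁)) * Complex.I * hq -
      E * (x₀ / (ω * p₁)) * g₀ * Complex.I_sq
  · refine (hE.mul (hX0.neg.add (hη.mul hX1))).congr_deriv ?_
    simp only [Pi.smul_apply, Matrix.cons_val_zero, Matrix.cons_val_one, smul_eq_mul,
      Function.comp_apply, Pi.sub_apply, Pi.add_apply, Pi.neg_apply, Pi.mul_apply]
    generalize Complex.exp _ = E
    generalize X₀ _ = x₀
    generalize X₁ _ = x₁
    rw [div_eq_mul_inv x₀, hinv]
    linear_combination E * eta ρ ω (θi + ω * t) * x₁ * Complex.I * (hq - hq2) +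
      (E * eta ρ ω (θi + ω * t) * x₁ * g₀ - E * x₀ * g₀) * Complex.I_sq

/-! ### The transfer matrix -/

theorem matM_mul_matMtilde {ω : ℝ} (hω : ω ≠ 0) {p₁ p₂ : ℂ} (hp₁ : p₁ ≠ 0)
    (hp₂ : ∀ n : ℕ, p₂ ≠ -n) (ζ : ℂ) :
    matM ω p₁ p₂ ζ * matMtilde ω p₁ p₂ ζ =
      (Complex.Gamma p₂ * Complex.exp (Complex.exp ζ - (p₂ - 1) * ζ) /
        (Complex.Gamma p₁ * p₁)) • (1 : Matrix (Fin 2) (Fin 2) ℂ) := by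
  have hωc : (ω : ℂ) ≠ 0 := by exact_mod_cast hω
  have hp₂0 : p₂ ≠ 0 := by simpa using hp₂ 0
  have hF1 := kummerF_succ_div p₁ (Complex.exp ζ) hp₂0
  have hW := kummerU_wronskian p₁ ζ hp₂
  have hexp : Complex.exp (Complex.exp ζ - (p₂ - 1) * ζ) =
      Complex.exp ζ * Complex.exp (Complex.exp ζ - p₂ * ζ) := by
    rw [← Complex.exp_add]; ring_nf
  rw [add_comm 1 p₁, Complex.Gamma_add_one p₁ hp₁, add_comm p₁ 1, mul_inv] at hW
  -- The product is scalar because `M̃` is `ω p₁` times the adjugate of `M`; the scalar `ω p₁ det M`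
  -- is the left side here.
  have key : Complex.exp ζ * (kummerF p₁ p₂ (Complex.exp ζ) * kummerU (1 + p₁) (1 + p₂) ζ +
      kummerU p₁ p₂ ζ * (kummerF (1 + p₁) (1 + p₂) (Complex.exp ζ) / p₂)) =
      Complex.Gamma p₂ * Complex.exp (Complex.exp ζ - (p₂ - 1) * ζ) /
        (Complex.Gamma p₁ * p₁) := by
    rw [hF1, hexp, kummerF_eq, div_eq_mul_inv, mul_inv]
    linear_combination (Complex.exp ζ * Complex.Gamma p₂) * hW
  rw [← key]
  ext i j
  fin_cases i <;> fin_cases j <;>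
    simp [matM, matMtilde, Matrix.mul_apply, Fin.sum_univ_two] <;> field_simp <;> ring

/-- The closed form of the transfer matrix. -/
def transferFormula (ρ ω : ℝ) (r p₁ p₂ c : ℂ) (θf θi : ℝ) : Matrix (Fin 2) (Fin 2) ℂ :=
  (Complex.Gamma p₁ * Complex.exp (Complex.I * (θf - θi) * r / ω) * p₁ *
      Complex.exp ((p₂ - 1) * logEta c θi) /
    (Complex.Gamma p₂ * Complex.exp ((eta ρ ω θf + eta ρ ω θi) / 2))) •
  (matM ω p₁ p₂ (logEta c θf) * matMtilde ω p₁ p₂ (logEta c θi))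

theorem transferFormula_self {ρ ω : ℝ} (hω : ω ≠ 0) {r p₁ p₂ c : ℂ} (hp₁ : ∀ n : ℕ, p₁ ≠ -n)
    (hp₂ : ∀ n : ℕ, p₂ ≠ -n) (hc : Complex.exp c = -2 * Complex.I * (ρ / ω)) (θ : ℝ) :
    transferFormula ρ ω r p₁ p₂ c θ θ = 1 := by
  have hp₁0 : p₁ ≠ 0 := by simpa using hp₁ 0
  have hG1 := Complex.Gamma_ne_zero hp₁
  have hG2 := Complex.Gamma_ne_zero hp₂
  rw [transferFormula, matM_mul_matMtilde hω hp₁0 hp₂, smul_smul, sub_eq_add_neg (Complex.exp _),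
    Complex.exp_add, Complex.exp_neg, exp_logEta hc, sub_self, mul_zero, zero_mul, zero_div,
    Complex.exp_zero, add_self_div_two]
  have h1 := Complex.exp_ne_zero ((p₂ - 1) * logEta c θ)
  have h2 := Complex.exp_ne_zero (eta ρ ω θ)
  convert! one_smul ℂ (1 : Matrix (Fin 2) (Fin 2) ℂ)
  field_simp

theorem isEvolution_transferFormula {g₀ ρ ω : ℝ} (hω : ω ≠ 0) {r p₁ p₂ c : ℂ}
    (hr : r ^ 2 = 1 - (g₀ : ℂ) ^ 2) (hp₁ : p₁ = (Complex.I * g₀ + r) / ω)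
    (hp₂ : p₂ = 1 + 2 * r / ω) (hp₁0 : p₁ ≠ 0) (hpole : ∀ n : ℕ, p₂ ≠ -n)
    (hc : Complex.exp c = -2 * Complex.I * (ρ / ω)) (θi : ℝ) (ψ₀ : Fin 2 → ℂ) :
    IsEvolution g₀ ρ ω θi fun t =>
      (transferFormula ρ ω r p₁ p₂ c (θi + ω * t) θi).mulVec ψ₀ := by
  have hωc : (ω : ℂ) ≠ 0 := by exact_mod_cast hω
  have hp₂0 : p₂ ≠ 0 := by simpa using hpole 0
  -- The choice of `X₁` is forced by `dF/dζ = e^ζ (p₁/p₂) F⁽¹⁾ = -p₁ e^ζ X₁`.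
  have hF := isEvolution_of_kummer_system hω hr hp₁ hp₂ hp₁0 hc
    (X₀ := fun ζ => kummerF p₁ p₂ (Complex.exp ζ))
    (X₁ := fun ζ => -(kummerF (1 + p₁) (1 + p₂) (Complex.exp ζ) / p₂))
    (fun ζ => by
      simp only [kummerF_succ_div _ _ hp₂0, kummerF_eq p₁ p₂]
      refine ((hasDerivAt_regF_exp p₁ p₂ ζ).const_mul (Complex.Gamma p₂)).congr_deriv ?_
      ring)
    (fun ζ => by
      simp only [kummerF_succ_div _ _ hp₂0, kummerF_eq p₁ p₂]
      refine ((hasDerivAt_regF_succ_exp p₁ p₂ ζ).const_mul (Complex.Gamma p₂)).neg.congr_deriv ?_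
      ring) θi
  have hU := isEvolution_of_kummer_system hω hr hp₁ hp₂ hp₁0 hc
    (fun ζ => hasDerivAt_kummerU p₁ hpole ζ) (fun ζ => hasDerivAt_kummerU_succ p₁ hpole ζ) θi
  -- Everything depending only on `θᵢ` goes into the constants `k` and `v`, so the formula is a
  -- fixed linear combination of the two solutions.
  set v := (matMtilde ω p₁ p₂ (logEta c θi)).mulVec ψ₀ with hv
  set k := Complex.Gamma p₁ * p₁ * Complex.exp ((p₂ - 1) * logEta c θi) /
    (Complex.Gamma p₂ * Complex.exp (eta ρ ω θi / 2)) with hk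
  convert! hF.linear_combination hU (k * v 0) (k * v 1) using 2 with t
  have hpre : Complex.Gamma p₁ * Complex.exp (Complex.I * ((θi + ω * t : ℝ) - θi) * r / ω) * p₁ *
      Complex.exp ((p₂ - 1) * logEta c θi) /
      (Complex.Gamma p₂ * Complex.exp ((eta ρ ω (θi + ω * t) + eta ρ ω θi) / 2)) =
      k * Complex.exp (Complex.I * r * t - eta ρ ω (θi + ω * t) / 2) := by
    rw [show Complex.I * ((θi + ω * t : ℝ) - θi) * r / ω = Complex.I * r * t by
      push_cast; field_simp; ring, add_div, Complex.exp_add, Complex.exp_sub, hk]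
    field_simp
  rw [transferFormula, hpre, Matrix.smul_mulVec, ← Matrix.mulVec_mulVec, ← hv]
  ext i
  fin_cases i
  · simp [matM, dotProduct, Fin.sum_univ_two]
    ring
  · simp [matM, dotProduct, Fin.sum_univ_two, exp_logEta hc]
    ring

theorem isTransferMatrix_transferFormula {g₀ ρ ω : ℝ} (hω : ω ≠ 0) {r p₁ p₂ c : ℂ}
    (hr : r ^ 2 = 1 - (g₀ : ℂ) ^ 2) (hp₁ : p₁ = (Complex.I * g₀ + r) / ω)
    (hp₂ : p₂ = 1 + 2 * r / ω) (hp₁n : ∀ n : ℕ, p₁ ≠ -n) (hpole : ∀ n : ℕ, p₂ ≠ -n)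
    (hc : Complex.exp c = -2 * Complex.I * (ρ / ω)) :
    IsTransferMatrix g₀ ρ ω (transferFormula ρ ω r p₁ p₂ c) := by
  intro θi ψ₀ ψ
  have hev := isEvolution_transferFormula hω hr hp₁ hp₂ (by simpa using hp₁n 0) hpole hc θi ψ₀
  have hinit : (transferFormula ρ ω r p₁ p₂ c (θi + ω * 0) θi).mulVec ψ₀ = ψ₀ := by
    rw [mul_zero, add_zero, transferFormula_self hω hp₁n hpole hc, Matrix.one_mulVec]
  constructor
  · rintro ⟨hψ, h0⟩ t
    exact congrFun (hψ.eq_of_initial hev (h0.trans hinit.symm)) t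
  · intro h
    obtain rfl := funext h
    exact ⟨hev, hinit⟩

theorem IsTransferMatrix.unique {g₀ ρ ω : ℝ} (hω : ω ≠ 0)
    {S T : ℝ → ℝ → Matrix (Fin 2) (Fin 2) ℂ} (hS : IsTransferMatrix g₀ ρ ω S)
    (hT : IsTransferMatrix g₀ ρ ω T) (θf θi : ℝ) : S θf θi = T θf θi := by
  refine Matrix.ext_of_mulVec_single fun i => ?_
  -- Since `ω ≠ 0`, every `θf` is reached, at time `(θf - θi)/ω`.
  have h := (hT θi (Pi.single i 1) _).1 ((hS θi (Pi.single i 1) _).2 fun _ => rfl)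
    ((θf - θi) / ω)
  rwa [mul_div_cancel₀ _ hω, add_sub_cancel] at h

/-- If `p₁ = -n`, then `r = -nω - i g₀`, and `r² = 1 - g₀²` reads `n²ω² + 2i nω g₀ = 1`. This forces
`n ≠ 0` and `g₀ = 0`, whence `p₂ = 1 - 2n` is an excluded value. -/
theorem ne_neg_nat_of_exponents {g₀ ω : ℝ} (hω : ω ≠ 0) {r p₁ p₂ : ℂ}
    (hr : r ^ 2 = 1 - (g₀ : ℂ) ^ 2) (hp₁ : p₁ = (Complex.I * g₀ + r) / ω)
    (hp₂ : p₂ = 1 + 2 * r / ω) (hpole : ∀ n : ℕ, p₂ ≠ -n) (n : ℕ) : p₁ ≠ -n := by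
  intro h
  have hωc : (ω : ℂ) ≠ 0 := by exact_mod_cast hω
  have hrn : r = -(n * ω) - Complex.I * g₀ := by
    rw [hp₁, div_eq_iff hωc] at h
    linear_combination h
  have hsq : (n : ℂ) ^ 2 * ω ^ 2 + 2 * Complex.I * (n * ω * g₀) = 1 := by
    rw [hrn] at hr
    linear_combination hr - (g₀ : ℂ) ^ 2 * Complex.I_sq
  have him := congrArg Complex.im hsq
  have hn : n ≠ 0 := by
    rintro rfl
    simp at hsq
  have hg : g₀ = 0 := by
    have e : (n : ℂ) ^ 2 * ω ^ 2 + 2 * Complex.I * (n * ω * g₀) =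
      ((n ^ 2 * ω ^ 2 : ℝ) : ℂ) + ((2 * (n * ω * g₀) : ℝ) : ℂ) * Complex.I := by push_cast; ring
    rw [e, Complex.add_im, Complex.ofReal_im, zero_add, Complex.im_ofReal_mul] at him
    simpa [hn, hω] using him
  refine hpole (2 * n - 1) ?_
  rw [hp₂, hrn, hg, Nat.cast_sub (by omega)]
  push_cast
  field_simp
  ring

end CircularLoop

end

theorem mainTheorem3 (g₀ ρ ω : ℝ) (hρ : 0 < ρ) (hω : ω ≠ 0)
    (r : ℂ) (hr : r ^ 2 = 1 - (g₀ : ℂ) ^ 2)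
    (p₁ p₂ : ℂ) (hp₁ : p₁ = (Complex.I * g₀ + r) / ω) (hp₂ : p₂ = 1 + 2 * r / ω)
    (hpole : ∀ n : ℕ, p₂ ≠ -n)
    (c : ℂ) (hc : Complex.exp c = -2 * Complex.I * (ρ / ω))
    (S : ℝ → ℝ → Matrix (Fin 2) (Fin 2) ℂ) :
    CircularLoop.IsTransferMatrix g₀ ρ ω S ↔
      ∀ θf θi : ℝ,
        S θf θi =
          (Complex.Gamma p₁ * Complex.exp (Complex.I * (θf - θi) * r / ω) * p₁ *
              Complex.exp ((p₂ - 1) * CircularLoop.logEta c θi) /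
            (Complex.Gamma p₂ *
              Complex.exp ((CircularLoop.eta ρ ω θf + CircularLoop.eta ρ ω θi) / 2))) •
          (CircularLoop.matM ω p₁ p₂ (CircularLoop.logEta c θf) *
            CircularLoop.matMtilde ω p₁ p₂ (CircularLoop.logEta c θi)) := by
  have hT := CircularLoop.isTransferMatrix_transferFormula hω hr hp₁ hp₂
    (CircularLoop.ne_neg_nat_of_exponents hω hr hp₁ hp₂ hpole) hpole hc
  refine ⟨fun hS => hS.unique hω hT, fun h => ?_⟩
  obtain rfl : S = CircularLoop.transferFormula ρ ω r p₁ p₂ c :=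
    funext fun θf => funext fun θi => h θf θi
  exact hT
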